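/- Let $\mathbb{H}$ be a real Hilbert space with an orthonormal basis $\mathcal{D}=\{\phi_j\}_{j\ge 1}$, let $\varepsilon>0$, and let $W=(W(h))_{h\in\mathbb{H}}$ be an isonormal process, i.e. a centered Gaussian process with $\mathbb{E}[W(g)W(h)]=\langle g,h\rangle$ for all $g,h\in\mathbb{H}$. For an unknown $f\in\mathbb{H}$ one observes $Y(h)=\langle f,h\rangle+\varepsilon W(h)$, $h\in\mathbb{H}$. For $q,r,R>0$ let $$\mathcal{L}_q(R)=\Big\{\sum_{j\ge1}\theta_j\phi_j\in\mathbb{H}:\ \sum_{j\ge 1}|\theta_j|^q\le R^q\Big\},\qquad \mathcal{B}^{r}_{2,\infty}(R)=\Big\{\sum_{j\ge1}\theta_j\phi_j\in\mathbb{H}:\ \sup_{J\ge 1}\Big(J^{2r}\sum_{j\ge J}\theta_j^2\Big)\le R^2\Big\}.$$ There is an absolute constant $\kappa>0$ such that the following holds for all such $\mathbb{H}$, $\mathcal{D}$, $W$ and $\varepsilon$. Let $1<q<2$, $0<r<1/q-1/2$ and $R>0$ be such that $R\varepsilon^{-1}\ge\max(e^2,u^2)$, where $u:=\frac1r-q\left(1+\frac{1}{2r}\right)$.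 Then $u>0$ and $$\inf_{\tilde f}\ \sup_{f\in\mathcal{L}_q(R)\cap\mathcal{B}^{r}_{2,\infty}(R)}\mathbb{E}\big[\|f-\tilde f\|^2\big]\ \ge\ \kappa\,u^{1-q/2}\,R^q\,\Big(\varepsilon\sqrt{\ln(R\varepsilon^{-1})}\Big)^{2-q},$$ where the infimum is taken over all estimators $\tilde f$, i.e. all $\mathbb{H}$-valued measurable functions of the observed process $Y$. -/

import Mathlib

open MeasureTheory ProbabilityTheory
open scoped ENNReal

noncomputable section

/-- A centered Gaussian process `W` indexed by a real Hilbert space `H` is isonormal if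
`𝔼[W g * W h] = ⟪g, h⟫` for all `g, h`. Each `W h` is a (measurable) real random variable, and
all finite-dimensional marginals are Gaussian. -/
structure IsIsonormal {H : Type*} [NormedAddCommGroup H] [InnerProductSpace ℝ H]
    {Ω : Type*} [MeasurableSpace Ω] (P : Measure Ω) (W : H → Ω → ℝ) : Prop where
  measurable : ∀ h, Measurable (W h)
  gaussian : IsGaussianProcess W P
  centered : ∀ h, ∫ ω, W h ω ∂P = 0
  covariance : ∀ g h, ∫ ω, W g ω * W h ω ∂P = inner ℝ g h

/-- The observed process `Y(h) = ⟪f, h⟫ + ε W(h)`, `h ∈ H`, when the target is `f`. -/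
def observation {H : Type*} [NormedAddCommGroup H] [InnerProductSpace ℝ H]
    {Ω : Type*} (W : H → Ω → ℝ) (ε : ℝ) (f : H) (ω : Ω) : H → ℝ :=
  fun h => inner ℝ f h + ε * W h ω

/-- The quadratic risk `𝔼[‖f - T(Y)‖²]` at the target `f` of the estimator `T(Y)`. -/
def quadraticRisk {H : Type*} [NormedAddCommGroup H] [InnerProductSpace ℝ H]
    {Ω : Type*} [MeasurableSpace Ω] (P : Measure Ω) (W : H → Ω → ℝ) (ε : ℝ)
    (T : (H → ℝ) → H) (f : H) : ℝ≥0∞ :=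
  ∫⁻ ω, ‖f - T (observation W ε f ω)‖ₑ ^ 2 ∂P

/-- The minimax quadratic risk over `S`. The infimum runs over all estimators, i.e. all
functions `T` of the observed process that are measurable from the product σ-algebra on `ℝ^H`
to the σ-algebra of `H`. -/
def gaussianMinimaxRisk {H : Type*} [NormedAddCommGroup H] [InnerProductSpace ℝ H] [MeasurableSpace H]
    {Ω : Type*} [MeasurableSpace Ω] (P : Measure Ω) (W : H → Ω → ℝ) (ε : ℝ) (S : Set H) :
    ℝ≥0∞ :=
  ⨅ (T : (H → ℝ) → H) (_ : Measurable T), ⨆ f ∈ S, quadraticRisk P W ε T f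

/-- The ball `L_q(R)`: all `g = ∑ j, θ j • φ j` with `∑ j, |θ j| ^ q ≤ R ^ q`. The coefficients
are `θ j = φ.repr g j`, and the sum is taken in `[0, ∞]`. -/
def lqBall {H : Type*} [NormedAddCommGroup H] [InnerProductSpace ℝ H]
    (φ : HilbertBasis ℕ+ ℝ H) (q R : ℝ) : Set H :=
  {g | ∑' j : ℕ+, ‖φ.repr g j‖ₑ ^ q ≤ ENNReal.ofReal R ^ q}

/-- The Besov ball `B^r_{2,∞}(R)`: all `g = ∑ j, θ j • φ j` with
`sup_{J ≥ 1} J ^ (2 r) * ∑_{j ≥ J} (θ j) ^ 2 ≤ R ^ 2`. -/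
def besovBall {H : Type*} [NormedAddCommGroup H] [InnerProductSpace ℝ H]
    (φ : HilbertBasis ℕ+ ℝ H) (r R : ℝ) : Set H :=
  {g | ⨆ J : ℕ+, ((J : ℕ) : ℝ≥0∞) ^ (2 * r) * ∑' j : Set.Ici J, ‖φ.repr g j‖ₑ ^ 2
    ≤ ENNReal.ofReal R ^ 2}

end

/-! ### Shifts of the observed process -/

section GaussianShift

/-! In a block of N coordinates, a bump of height εt at an unknown position cannot be told reliably
from no bump while exp(t²) ≤ N + 1: the summed likelihood ratio of the N positions then has second
moment at most twice its squared mean. This gives `card_le_two_mul_lintegral_min` and rests on the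
Cameron–Martin formula. Any estimator therefore pays order (εt)² per block.

Draw bump or no bump, and the position, uniformly and independently in m disjoint blocks. Fixing the
other blocks turns the test into a Bayes risk of at least m(εt)²/8, which bounds the minimax risk
from below (`IsIsonormal.blockSparse_risk_lower_bound`).

With A = R/(εt), the L_q ball allows m ≈ A^q bumps. As they lie among the first mN coordinates, the
Besov ball allows N ≈ A^u, and exp(t²) ≤ N + 1 then permits t² of order u log(R/ε)
(`exists_block_parameters`). -/

theorem lintegral_gaussianReal_add_const (c : ℝ) {F : ℝ → ℝ≥0∞} (hF : Measurable F) :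
    ∫⁻ z, F (z + c) ∂(gaussianReal 0 1)
      = ∫⁻ z, ENNReal.ofReal (Real.exp (c * z - c ^ 2 / 2)) * F z ∂(gaussianReal 0 1) := by
  have h1 : ∫⁻ z, F (z + c) ∂(gaussianReal 0 1) = ∫⁻ z, F z ∂(gaussianReal c 1) := by
    have := gaussianReal_map_add_const (μ := 0) (v := 1) c
    rw [zero_add] at this
    rw [← this, lintegral_map hF (measurable_add_const c)]
  rw [h1, gaussianReal_of_var_ne_zero _ one_ne_zero, gaussianReal_of_var_ne_zero _ one_ne_zero,
    lintegral_withDensity_eq_lintegral_mul _ (measurable_gaussianPDF _ _) hF,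
    lintegral_withDensity_eq_lintegral_mul _ (measurable_gaussianPDF _ _) (by fun_prop)]
  refine lintegral_congr fun z => ?_
  simp only [Pi.mul_apply]
  rw [← mul_assoc]
  congr 1
  rw [gaussianPDF, gaussianPDF, ← ENNReal.ofReal_mul (gaussianPDFReal_nonneg _ _ _),
    gaussianPDFReal, gaussianPDFReal, mul_assoc _ (Real.exp _), ← Real.exp_add]
  congr 3
  simp only [NNReal.coe_one]
  ring

variable {H : Type*} [NormedAddCommGroup H] [InnerProductSpace ℝ H]
  {Ω : Type*} {W : H → Ω → ℝ}

theorem observation_add (ε : ℝ) (f g : H) (ω : Ω) :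
    observation W ε (f + g) ω = (fun h => inner ℝ f h) + observation W ε g ω := by
  funext h
  simp [observation, inner_add_left, add_assoc]

variable [MeasurableSpace Ω] {P : Measure Ω}

theorem measurable_observation (hW : ∀ h, Measurable (W h)) (ε : ℝ) (f : H) :
    Measurable (observation W ε f) :=
  measurable_pi_lambda _ fun h => ((hW h).const_mul ε).const_add _

namespace IsIsonormal

theorem map_eq_gaussianReal (hW : IsIsonormal P W) {e : H} (he : ‖e‖ = 1) :
    P.map (W e) = gaussianReal 0 1 := by
  have hg := hW.gaussian.hasGaussianLaw_eval e
  have := hg.isProbabilityMeasure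
  rw [hg.map_eq_gaussianReal, hW.centered]
  congr
  rw [variance_of_integral_eq_zero (hW.measurable e).aemeasurable (hW.centered e)]
  have := hW.covariance e e
  simp only [real_inner_self_eq_norm_sq, he, one_pow, ← pow_two] at this
  simp [this]

theorem memLp_two (hW : IsIsonormal P W) (h : H) : MemLp (W h) 2 P :=
  (hW.gaussian.hasGaussianLaw_eval h).memLp_two

/-- The residual is jointly Gaussian with `W e` and uncorrelated with it, hence independent. -/
theorem indepFun_residual (hW : IsIsonormal P W) {e : H} (he : ‖e‖ = 1) :
    IndepFun (fun ω (h : H) => W h ω - inner ℝ h e * W e ω) (W e) P := by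
  have := hW.gaussian.isProbabilityMeasure
  have hm : ∀ h : H, Measurable fun ω => W h ω - inner ℝ h e * W e ω := fun h =>
    (hW.measurable h).sub ((hW.measurable e).const_mul _)
  have key : IndepFun (fun ω (h : H) => W h ω - inner ℝ h e * W e ω)
      (fun ω (_ : Unit) => W e ω) P := by
    refine IsGaussianProcess.indepFun_of_covariance_eq_zero
      (X := fun (h : H) ω => W h ω - inner ℝ h e * W e ω) (Y := fun (_ : Unit) => W e) ?_
      (fun h => (hm h).aemeasurable) (fun _ => (hW.measurable e).aemeasurable) ?_
    · classical
      refine hW.gaussian.of_isGaussianProcess ?_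
      rintro (h | _)
      · exact ⟨{h, e}, .proj ⟨h, by simp⟩ - (inner ℝ h e : ℝ) • .proj ⟨e, by simp⟩,
          fun ω => by simp⟩
      · exact ⟨{e}, .proj ⟨e, by simp⟩, fun ω => by simp⟩
    · rintro h -
      have h1 : (fun ω => W h ω - inner ℝ h e * W e ω) = W h - fun ω => inner ℝ h e * W e ω := rfl
      have hc : ∀ g, cov[W g, W e; P] = inner ℝ g e := fun g => by
        rw [covariance_eq_sub (hW.memLp_two g) (hW.memLp_two e), hW.centered, zero_mul, sub_zero]
        exact hW.covariance g e
      rw [h1, covariance_sub_left (hW.memLp_two h) ((hW.memLp_two e).const_mul _)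
        (hW.memLp_two e), covariance_const_mul_left, hc, hc, real_inner_self_eq_norm_sq, he]
      simp
  exact key.comp measurable_id (measurable_pi_apply ())

/-- Cameron–Martin formula for a shift of the observed process along a unit vector. -/
theorem lintegral_observation_smul (hW : IsIsonormal P W) {e : H} (he : ‖e‖ = 1) (ε t : ℝ)
    {G : (H → ℝ) → ℝ≥0∞} (hG : Measurable G) :
    ∫⁻ ω, G (observation W ε ((ε * t) • e) ω) ∂P
      = ∫⁻ ω, ENNReal.ofReal (Real.exp (t * W e ω - t ^ 2 / 2)) * G (observation W ε 0 ω) ∂P := by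
  have := hW.gaussian.isProbabilityMeasure
  -- The shift along `e` leaves the residual `V` unchanged and only translates the independent
  -- standard Gaussian `W e`, so Fubini reduces the claim to one dimension.
  set V : Ω → H → ℝ := fun ω h => W h ω - inner ℝ h e * W e ω with hVdef
  have hV : Measurable V := measurable_pi_lambda _ fun h =>
    (hW.measurable h).sub ((hW.measurable e).const_mul _)
  let ψ : (H → ℝ) × ℝ → H → ℝ := fun p h => ε * p.1 h + inner ℝ h e * (ε * p.2)
  have hψ : Measurable ψ := measurable_pi_lambda _ fun h => by fun_prop
  have hobs : ∀ s ω, observation W ε ((ε * s) • e) ω = ψ (V ω, W e ω + s) := fun s ω => by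
    funext h
    simp only [observation, ψ, V, inner_smul_left, real_inner_comm e h]
    simp
    ring
  have hobs0 : ∀ ω, observation W ε 0 ω = ψ (V ω, W e ω) := fun ω => by
    simpa using hobs 0 ω
  have hlaw : P.map (fun ω => (V ω, W e ω)) = (P.map V).prod (gaussianReal 0 1) := by
    rw [← hW.map_eq_gaussianReal he]
    exact (indepFun_iff_map_prod_eq_prod_map_map hV.aemeasurable
      (hW.measurable e).aemeasurable).1 (hW.indepFun_residual he)
  have hVW : Measurable fun ω => (V ω, W e ω) := hV.prodMk (hW.measurable e)
  have hprob : IsProbabilityMeasure (P.map V) := Measure.isProbabilityMeasure_map hV.aemeasurable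
  have hL : Measurable fun p : (H → ℝ) × ℝ => G (ψ (p.1, p.2 + t)) :=
    hG.comp (hψ.comp (by fun_prop))
  have hR : Measurable fun p : (H → ℝ) × ℝ =>
      ENNReal.ofReal (Real.exp (t * p.2 - t ^ 2 / 2)) * G (ψ p) :=
    Measurable.mul (by fun_prop) (hG.comp hψ)
  simp only [hobs, hobs0]
  rw [← lintegral_map (f := fun p : (H → ℝ) × ℝ => G (ψ (p.1, p.2 + t))) hL hVW,
    ← lintegral_map (f := fun p : (H → ℝ) × ℝ =>
      ENNReal.ofReal (Real.exp (t * p.2 - t ^ 2 / 2)) * G (ψ p)) hR hVW,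
    hlaw, lintegral_prod _ hL.aemeasurable, lintegral_prod _ hR.aemeasurable]
  refine lintegral_congr fun v => ?_
  exact lintegral_gaussianReal_add_const t (F := fun z => G (ψ (v, z)))
    (hG.comp (hψ.comp (by fun_prop)))

end IsIsonormal

end GaussianShift

/-! ### Testing for one bump at an unknown position -/

section BlockBound

variable {H : Type*} [NormedAddCommGroup H] [InnerProductSpace ℝ H]
  {Ω : Type*} [MeasurableSpace Ω] {P : Measure Ω} {W : H → Ω → ℝ}

namespace IsIsonormal

theorem lintegral_likelihood (hW : IsIsonormal P W) {e : H} (he : ‖e‖ = 1) (t : ℝ) :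
    ∫⁻ ω, ENNReal.ofReal (Real.exp (t * W e ω - t ^ 2 / 2)) ∂P = 1 := by
  have := hW.gaussian.isProbabilityMeasure
  have h := hW.lintegral_observation_smul he 1 t (G := fun _ => 1) measurable_const
  simpa using h.symm

/-- The first factor acts as a change of measure that moves `W e'` by t⟪e, e'⟫. -/
theorem lintegral_likelihood_mul_likelihood (hW : IsIsonormal P W) {e e' : H} (he : ‖e‖ = 1)
    (he' : ‖e'‖ = 1) (t : ℝ) :
    ∫⁻ ω, ENNReal.ofReal (Real.exp (t * W e ω - t ^ 2 / 2)) *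
        ENNReal.ofReal (Real.exp (t * W e' ω - t ^ 2 / 2)) ∂P
      = ENNReal.ofReal (Real.exp (t ^ 2 * inner ℝ e e')) := by
  have h := hW.lintegral_observation_smul he 1 t
    (G := fun y => ENNReal.ofReal (Real.exp (t * y e' - t ^ 2 / 2))) (by fun_prop)
  simp only [observation, inner_zero_left, one_mul, zero_add] at h
  rw [← h]
  have h2 : ∀ ω, ENNReal.ofReal (Real.exp (t * (inner ℝ (t • e) e' + W e' ω) - t ^ 2 / 2))
      = ENNReal.ofReal (Real.exp (t ^ 2 * inner ℝ e e')) *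
        ENNReal.ofReal (Real.exp (t * W e' ω - t ^ 2 / 2)) := fun ω => by
    rw [← ENNReal.ofReal_mul (Real.exp_nonneg _), ← Real.exp_add, inner_smul_left]
    congr 2
    simp
    ring
  simp only [h2]
  rw [lintegral_const_mul' _ _ ENNReal.ofReal_ne_top, hW.lintegral_likelihood he', mul_one]

/-- Second moment of the sum of the likelihood ratios of `N` orthogonal shifts. -/
theorem lintegral_sum_likelihood_sq (hW : IsIsonormal P W) {N : ℕ} {e : Fin N → H}
    (he : Orthonormal ℝ e) {t : ℝ} (ht : Real.exp (t ^ 2) ≤ N + 1) :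
    ∫⁻ ω, (∑ i, ENNReal.ofReal (Real.exp (t * W (e i) ω - t ^ 2 / 2))) ^ 2 ∂P
      ≤ 2 * (N : ℝ≥0∞) ^ 2 := by
  have hm : ∀ i, Measurable fun ω => ENNReal.ofReal (Real.exp (t * W (e i) ω - t ^ 2 / 2)) :=
    fun i => by have := hW.measurable (e i); fun_prop
  have hmm : ∀ i j, Measurable fun ω => ENNReal.ofReal (Real.exp (t * W (e i) ω - t ^ 2 / 2)) *
      ENNReal.ofReal (Real.exp (t * W (e j) ω - t ^ 2 / 2)) := fun i j => (hm i).mul (hm j)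
  simp only [pow_two (∑ i, _), Finset.sum_mul_sum]
  rw [lintegral_finsetSum _ fun i _ => Finset.measurable_sum _ fun j _ => hmm i j]
  have h1 : ∀ i, ∫⁻ ω, ∑ j, ENNReal.ofReal (Real.exp (t * W (e i) ω - t ^ 2 / 2)) *
        ENNReal.ofReal (Real.exp (t * W (e j) ω - t ^ 2 / 2)) ∂P ≤ 2 * N := fun i => by
    rw [lintegral_finsetSum _ fun j _ => hmm i j]
    simp only [hW.lintegral_likelihood_mul_likelihood (he.1 _) (he.1 _)]
    -- Off-diagonal terms equal 1 by orthogonality; the diagonal one is exp(t²) ≤ N + 1.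
    calc ∑ j, ENNReal.ofReal (Real.exp (t ^ 2 * inner ℝ (e i) (e j)))
        ≤ ∑ j, (1 + if i = j then (N : ℝ≥0∞) else 0) := by
          refine Finset.sum_le_sum fun j _ => ?_
          rw [orthonormal_iff_ite.1 he i j]
          split_ifs
          · rw [mul_one, add_comm]
            refine (ENNReal.ofReal_le_ofReal ht).trans_eq ?_
            rw [ENNReal.ofReal_add (by positivity) zero_le_one, ENNReal.ofReal_natCast,
              ENNReal.ofReal_one]
          · simp
      _ = 2 * N := by
          rw [Finset.sum_add_distrib]
          simp [two_mul]
  calc _ ≤ ∑ _i : Fin N, 2 * (N : ℝ≥0∞) := Finset.sum_le_sum fun i _ => h1 i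
    _ = 2 * (N : ℝ≥0∞) ^ 2 := by simp; ring

theorem card_le_two_mul_lintegral_min (hW : IsIsonormal P W) {N : ℕ} {e : Fin N → H}
    (he : Orthonormal ℝ e) {t : ℝ} (ht : Real.exp (t ^ 2) ≤ N + 1) :
    (N : ℝ≥0∞) ≤ 2 * ∫⁻ ω,
      min (N : ℝ≥0∞) (∑ i, ENNReal.ofReal (Real.exp (t * W (e i) ω - t ^ 2 / 2))) ∂P := by
  rcases Nat.eq_zero_or_pos N with rfl | hN
  · simp
  set S : Ω → ℝ≥0∞ := fun ω => ∑ i, ENNReal.ofReal (Real.exp (t * W (e i) ω - t ^ 2 / 2)) with hS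
  have hm : ∀ i, Measurable fun ω => ENNReal.ofReal (Real.exp (t * W (e i) ω - t ^ 2 / 2)) :=
    fun i => by have := hW.measurable (e i); fun_prop
  have hSm : Measurable S := Finset.measurable_sum _ fun i _ => hm i
  have hN0 : (N : ℝ≥0∞) ≠ 0 := by positivity
  have hNt : (N : ℝ≥0∞) ≠ ∞ := ENNReal.natCast_ne_top N
  -- For S ≥ N this is (S - 2N)² ≥ 0. Integrating, with mean N and second moment at most 2N², bounds
  -- the mean of min(N, S) below by N/2.
  have hpt : ∀ ω, 4 * (N : ℝ≥0∞) * S ω ≤ 4 * N * min (N : ℝ≥0∞) (S ω) + S ω ^ 2 := fun ω => by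
    have hfin : S ω ≠ ∞ := by simp [hS]
    lift S ω to NNReal using hfin with s
    have : 4 * (N : NNReal) * s ≤ 4 * N * min (N : NNReal) s + s ^ 2 := by
      rw [← NNReal.coe_le_coe]
      push_cast
      rcases le_total (N : ℝ) s with h | h
      · rw [min_eq_left h]
        nlinarith [sq_nonneg ((s : ℝ) - 2 * N)]
      · rw [min_eq_right h]
        nlinarith [sq_nonneg (s : ℝ)]
    exact_mod_cast this
  have hSint : ∫⁻ ω, S ω ∂P = N := by
    rw [lintegral_finsetSum _ fun i _ => hm i]
    simp [hW.lintegral_likelihood (he.1 _)]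
  have hint := lintegral_mono (μ := P) hpt
  rw [lintegral_const_mul _ hSm, lintegral_add_right _ (hSm.pow_const 2),
    lintegral_const_mul _ (measurable_const.min hSm), hSint] at hint
  have h2 := hint.trans (add_le_add_right (hW.lintegral_sum_likelihood_sq he ht) _)
  have h3 : 2 * (N : ℝ≥0∞) * N ≤ 2 * N * (2 * ∫⁻ ω, min (N : ℝ≥0∞) (S ω) ∂P) := by
    have hf : 2 * (N : ℝ≥0∞) ^ 2 ≠ ∞ := by finiteness
    rw [← ENNReal.add_le_add_iff_right hf]
    calc _ = 4 * (N : ℝ≥0∞) * N := by ring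
      _ ≤ _ := h2
      _ = _ := by ring
  rwa [ENNReal.mul_le_mul_iff_right (by simpa using hN.ne') (by finiteness)] at h3

/-- Testing no signal against a signal of strength `ε * t` at an unknown one among `N`
orthogonal positions. -/
theorem mixture_risk_lower_bound (hW : IsIsonormal P W) {N : ℕ} {e : Fin N → H}
    (he : Orthonormal ℝ e) {t : ℝ} (ht : Real.exp (t ^ 2) ≤ N + 1) (ε : ℝ) (f : H)
    {G₀ : (H → ℝ) → ℝ≥0∞} {G : Fin N → (H → ℝ) → ℝ≥0∞} (hG₀ : Measurable G₀)
    (hG : ∀ i, Measurable (G i)) {c : ℝ≥0∞} (hc : ∀ i y, c ≤ G₀ y + G i y) :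
    N * c ≤ 2 * ∑ i, (∫⁻ ω, G₀ (observation W ε f ω) ∂P
      + ∫⁻ ω, G i (observation W ε (f + (ε * t) • e i) ω) ∂P) := by
  have hT : Measurable fun y : H → ℝ => (fun h => inner ℝ f h) + y := measurable_const_add _
  have hobs : ∀ g, Measurable (observation W ε g) := measurable_observation hW.measurable ε
  have hm : ∀ i, Measurable fun ω => ENNReal.ofReal (Real.exp (t * W (e i) ω - t ^ 2 / 2)) :=
    fun i => by have := hW.measurable (e i); fun_prop
  have h1 : ∀ i, ∫⁻ ω, G i (observation W ε (f + (ε * t) • e i) ω) ∂P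
      = ∫⁻ ω, ENNReal.ofReal (Real.exp (t * W (e i) ω - t ^ 2 / 2)) *
          G i (observation W ε f ω) ∂P := fun i => by
    have := hW.lintegral_observation_smul (he.1 i) ε t ((hG i).comp hT)
    simp only [Function.comp_apply, ← observation_add, add_zero] at this
    exact this
  have hGm : ∀ i, Measurable fun ω => G i (observation W ε f ω) := fun i => (hG i).comp (hobs f)
  have hG₀m : Measurable fun ω => G₀ (observation W ε f ω) := hG₀.comp (hobs f)
  simp only [h1]
  calc N * c ≤ (2 * ∫⁻ ω, min (N : ℝ≥0∞)
        (∑ i, ENNReal.ofReal (Real.exp (t * W (e i) ω - t ^ 2 / 2))) ∂P) * c := by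
        gcongr
        exact hW.card_le_two_mul_lintegral_min he ht
    _ = 2 * ∫⁻ ω, min (N : ℝ≥0∞)
        (∑ i, ENNReal.ofReal (Real.exp (t * W (e i) ω - t ^ 2 / 2))) * c ∂P := by
        rw [mul_assoc, lintegral_mul_const _
          (measurable_const.min (Finset.measurable_sum _ fun i _ => hm i))]
    _ ≤ 2 * ∫⁻ ω, ∑ i, (G₀ (observation W ε f ω) +
        ENNReal.ofReal (Real.exp (t * W (e i) ω - t ^ 2 / 2)) * G i (observation W ε f ω)) ∂P := by
        gcongr with ω
        generalize observation W ε f ω = y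
        rw [Finset.sum_add_distrib, Finset.sum_const, Finset.card_univ, Fintype.card_fin,
          nsmul_eq_mul]
        set S := ∑ i, ENNReal.ofReal (Real.exp (t * W (e i) ω - t ^ 2 / 2)) with hS
        have hle : ∀ i, c - G₀ y ≤ G i y := fun i => tsub_le_iff_left.2 (hc i y)
        -- Splitting c into G₀ and the excess c - G₀ ≤ Gᵢ, the minimum is bounded by N on the first
        -- part and by S on the second.
        calc min (N : ℝ≥0∞) S * c ≤ min (N : ℝ≥0∞) S * (G₀ y + (c - G₀ y)) := by
              gcongr
              exact le_add_tsub
          _ ≤ N * G₀ y + S * (c - G₀ y) := by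
              rw [mul_add]
              gcongr
              · exact min_le_left _ _
              · exact min_le_right _ _
          _ ≤ _ := by
              rw [hS, Finset.sum_mul]
              gcongr
              exact hle _
    _ = _ := by
        have hsum : ∀ i, Measurable fun ω => G₀ (observation W ε f ω) +
            ENNReal.ofReal (Real.exp (t * W (e i) ω - t ^ 2 / 2)) * G i (observation W ε f ω) :=
          fun i => hG₀m.add ((hm i).mul (hGm i))
        rw [lintegral_finsetSum _ fun i _ => hsum i]
        congr 2
        funext i
        rw [lintegral_add_left hG₀m]

end IsIsonormal

end BlockBound

/-! ### Product prior over blocks -/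

section BlockSparse

/-- Resampling one coordinate preserves the uniform law: exchanging the entry at `b` with `v` is an
involution on pairs. -/
theorem sum_sum_update {ι V M : Type*} [Fintype ι] [DecidableEq ι] [Fintype V] [CommSemiring M]
    (b : ι) (F : (ι → V) → M) :
    ∑ s, ∑ v, F (Function.update s b v) = Fintype.card V * ∑ s, F s := by
  have hinv : Function.Involutive
      fun p : (ι → V) × V => (Function.update p.1 b p.2, p.1 b) := fun p => by simp
  calc ∑ s, ∑ v, F (Function.update s b v)
      = ∑ p : (ι → V) × V, F (hinv.toPerm _ p).1 := by
        rw [← Fintype.sum_prod_type' fun s v => F (Function.update s b v)]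
        rfl
    _ = Fintype.card V * ∑ s, F s := by
        rw [Equiv.sum_comp (hinv.toPerm _) fun p => F p.1, Fintype.sum_prod_type, Finset.mul_sum]
        simp

variable {H : Type*} [NormedAddCommGroup H] [InnerProductSpace ℝ H] {m N : ℕ}

/-- The signal that, in each block `b`, has amplitude `a` or `0` (according to `(s b).1`) at the
position `(s b).2`, and vanishes elsewhere. -/
noncomputable def blockSignal (e : Fin m × Fin N → H) (a : ℝ) (s : Fin m → Bool × Fin N) : H :=
  ∑ b, (if (s b).1 then a else 0) • e (b, (s b).2)

theorem blockSignal_update (e : Fin m × Fin N → H) (a : ℝ) (s : Fin m → Bool × Fin N) (b : Fin m)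
    (v : Bool × Fin N) :
    blockSignal e a (Function.update s b v)
      = (∑ b' ∈ Finset.univ.erase b, (if (s b').1 then a else 0) • e (b', (s b').2))
        + (if v.1 then a else 0) • e (b, v.2) := by
  rw [blockSignal, ← Finset.sum_erase_add _ _ (Finset.mem_univ b)]
  congr 1
  · refine Finset.sum_congr rfl fun b' hb' => ?_
    rw [Function.update_of_ne (Finset.ne_of_mem_erase hb')]
  · simp

/-- The quadratic loss at `z` within block `b`, when the signal there is described by `v`. -/
noncomputable def blockLoss (e : Fin m × Fin N → H) (a : ℝ) (b : Fin m) (v : Bool × Fin N) (z : H) : ℝ≥0∞ :=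
  ∑ i, ENNReal.ofReal (((if v.1 = true ∧ v.2 = i then a else 0) - inner ℝ (e (b, i)) z) ^ 2)

theorem inner_blockSignal {e : Fin m × Fin N → H} (he : Orthonormal ℝ e) (a : ℝ)
    (s : Fin m → Bool × Fin N) (b : Fin m) (i : Fin N) :
    inner ℝ (e (b, i)) (blockSignal e a s) = if (s b).1 = true ∧ (s b).2 = i then a else 0 := by
  rw [blockSignal, inner_sum, Finset.sum_eq_single b]
  · rw [inner_smul_right, orthonormal_iff_ite.1 he]
    by_cases h : (s b).2 = i
    · simp [h]
    · simp [h, Ne.symm h]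
  · intro b' _ hb'
    rw [inner_smul_right, he.2 (by simp [Ne.symm hb']), mul_zero]
  · simp

/-- This is Bessel's inequality for the error vector. -/
theorem sum_blockLoss_le {e : Fin m × Fin N → H} (he : Orthonormal ℝ e) (a : ℝ)
    (s : Fin m → Bool × Fin N) (z : H) :
    ∑ b, blockLoss e a b (s b) z ≤ ‖blockSignal e a s - z‖ₑ ^ 2 := by
  have h1 : ∀ b, blockLoss e a b (s b) z
      = ∑ i, ENNReal.ofReal (‖(inner ℝ (e (b, i)) (blockSignal e a s - z) : ℝ)‖ ^ 2) := fun b => by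
    refine Finset.sum_congr rfl fun i _ => ?_
    rw [inner_sub_right, inner_blockSignal he, Real.norm_eq_abs, sq_abs]
  simp only [h1]
  rw [← Fintype.sum_prod_type'
      (f := fun b i => ENNReal.ofReal (‖(inner ℝ (e (b, i)) (blockSignal e a s - z) : ℝ)‖ ^ 2)),
    ← ENNReal.ofReal_sum_of_nonneg fun _ _ => by positivity,
    ← ofReal_norm, ← ENNReal.ofReal_pow (norm_nonneg _)]
  exact ENNReal.ofReal_le_ofReal (he.sum_inner_products_le _)

theorem le_blockLoss_add_blockLoss (e : Fin m × Fin N → H) (a : ℝ) (b : Fin m) (j i : Fin N)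
    (z : H) :
    ENNReal.ofReal (a ^ 2 / 2) ≤ blockLoss e a b (false, j) z + blockLoss e a b (true, i) z := by
  rw [blockLoss, blockLoss]
  refine le_trans ?_ (add_le_add (Finset.single_le_sum (fun _ _ => zero_le) (Finset.mem_univ i))
    (Finset.single_le_sum (fun _ _ => zero_le) (Finset.mem_univ i)))
  rw [← ENNReal.ofReal_add (sq_nonneg _) (sq_nonneg _)]
  refine ENNReal.ofReal_le_ofReal ?_
  simp
  nlinarith [sq_nonneg (a - 2 * inner ℝ (e (b, i)) z)]

theorem measurable_blockLoss [MeasurableSpace H] [BorelSpace H] (e : Fin m × Fin N → H) (a : ℝ)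
    (b : Fin m) (v : Bool × Fin N) : Measurable (blockLoss e a b v) := by
  unfold blockLoss
  refine Finset.measurable_sum _ fun i _ => ?_
  exact ENNReal.measurable_ofReal.comp (Continuous.measurable (by fun_prop))

/-- Lower bound for the minimax risk over a set containing all block-sparse signals. -/
theorem IsIsonormal.blockSparse_risk_lower_bound [MeasurableSpace H] [BorelSpace H]
    {Ω : Type*} [MeasurableSpace Ω] {P : Measure Ω} {W : H → Ω → ℝ} (hW : IsIsonormal P W)
    {e : Fin m × Fin N → H} (he : Orthonormal ℝ e) (hN : 0 < N) {t : ℝ}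
    (ht : Real.exp (t ^ 2) ≤ N + 1) (ε : ℝ) {S : Set H}
    (hS : ∀ s, blockSignal e (ε * t) s ∈ S) :
    m * ENNReal.ofReal ((ε * t) ^ 2 / 2) ≤ 4 * gaussianMinimaxRisk P W ε S := by
  have hNe : Nonempty (Fin N) := ⟨⟨0, hN⟩⟩
  rw [mul_comm 4, ← ENNReal.div_le_iff_le_mul (by simp) (by simp), gaussianMinimaxRisk]
  refine le_iInf₂ fun T hT => ?_
  rw [ENNReal.div_le_iff_le_mul (by simp) (by simp), mul_comm _ 4]
  set a := ε * t with ha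
  set c := ENNReal.ofReal (a ^ 2 / 2) with hcdef
  have hLm : ∀ b v, Measurable fun y => blockLoss e a b v (T y) := fun b v =>
    (measurable_blockLoss e a b v).comp hT
  have hobs : ∀ g, Measurable (observation W ε g) := measurable_observation hW.measurable ε
  let risk : Fin m → (Fin m → Bool × Fin N) → ℝ≥0∞ := fun b s =>
    ∫⁻ ω, blockLoss e a b (s b) (T (observation W ε (blockSignal e a s) ω)) ∂P
  have hblock : ∀ b s, N * c ≤ 2 * ∑ v, risk b (Function.update s b v) := fun b s => by
    have heb : Orthonormal ℝ fun i => e (b, i) := he.comp _ (Prod.mk_right_injective b)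
    have hloss : ∀ i j, blockLoss e a b (false, i) = blockLoss e a b (false, j) := fun i j => by
      funext z
      simp [blockLoss]
    have key := hW.mixture_risk_lower_bound heb ht ε
      (∑ b' ∈ Finset.univ.erase b, (if (s b').1 then a else 0) • e (b', (s b').2))
      (hLm b (false, ⟨0, hN⟩)) (fun i => hLm b (true, i))
      (fun i y => le_blockLoss_add_blockLoss e a b ⟨0, hN⟩ i (T y))
    refine key.trans_eq ?_
    -- The position label is irrelevant when there is no bump, so the N copies of the null risk are
    -- the terms `v = (false, i)`.
    rw [Fintype.sum_prod_type, Fintype.sum_bool, ← Finset.sum_add_distrib]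
    congr 1
    refine Finset.sum_congr rfl fun i _ => ?_
    rw [add_comm]
    simp only [risk, blockSignal_update, Function.update_self]
    simp [hloss i ⟨0, hN⟩, ← ha]
  have hsum : ∀ b, Fintype.card (Fin m → Bool × Fin N) * c ≤ 4 * ∑ s, risk b s := fun b => by
    -- Each block has 2N states, so averaging gives the factor 2 · 2N, and cancelling N leaves 4.
    have h := Finset.sum_le_sum fun s (_ : s ∈ Finset.univ) => hblock b s
    rw [← Finset.mul_sum (f := fun s => ∑ v, risk b (Function.update s b v)), sum_sum_update,
      Finset.sum_const, nsmul_eq_mul, Finset.card_univ] at h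
    rw [← ENNReal.mul_le_mul_iff_right (a := (N : ℝ≥0∞)) (by simpa using hN.ne') (by simp)]
    calc _ = (Fintype.card (Fin m → Bool × Fin N) : ℝ≥0∞) * (N * c) := by ring
      _ ≤ _ := h
      _ = _ := by
        simp only [Fintype.card_prod, Fintype.card_bool, Fintype.card_fin]
        push_cast
        ring
  have hrisk : ∀ s, ∑ b, risk b s ≤ ⨆ f ∈ S, quadraticRisk P W ε T f := fun s => by
    refine le_trans ?_ (le_iSup₂ (f := fun f _ => quadraticRisk P W ε T f) _ (hS s))
    have hm : ∀ b, Measurable fun ω =>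
        blockLoss e a b (s b) (T (observation W ε (blockSignal e a s) ω)) :=
      fun b => (hLm b (s b)).comp (hobs _)
    simp only [risk, quadraticRisk]
    rw [← lintegral_finsetSum _ fun b _ => hm b]
    exact lintegral_mono fun ω => sum_blockLoss_le he a s _
  have hcard : (Fintype.card (Fin m → Bool × Fin N) : ℝ≥0∞) ≠ 0 := by
    simpa using Fintype.card_ne_zero (α := Fin m → Bool × Fin N)
  rw [← ENNReal.mul_le_mul_iff_right hcard (ENNReal.natCast_ne_top _)]
  calc _ = ∑ _b : Fin m, (Fintype.card (Fin m → Bool × Fin N) : ℝ≥0∞) * c := by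
        rw [Finset.sum_const, nsmul_eq_mul, Finset.card_univ, Fintype.card_fin]
        ring
    _ ≤ ∑ b, 4 * ∑ s, risk b s := Finset.sum_le_sum fun b _ => hsum b
    _ = 4 * ∑ s, ∑ b, risk b s := by rw [← Finset.mul_sum, Finset.sum_comm]
    _ ≤ 4 * ∑ _s : Fin m → Bool × Fin N, ⨆ f ∈ S, quadraticRisk P W ε T f := by
        gcongr with s
        exact hrisk s
    _ = _ := by
        rw [Finset.sum_const, nsmul_eq_mul, Finset.card_univ]
        ring

end BlockSparse

/-! ### Block signals lie in both balls -/

section SparseBalls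

variable {H : Type*} [NormedAddCommGroup H] [InnerProductSpace ℝ H] {φ : HilbertBasis ℕ+ ℝ H}

theorem tsum_enorm_repr_rpow {g : H} {F : Finset ℕ+} {a : ℝ}
    (hg : ∀ j, φ.repr g j = if j ∈ F then a else 0) {q : ℝ} (hq : 0 < q) :
    ∑' j : ℕ+, ‖φ.repr g j‖ₑ ^ q = F.card * ‖a‖ₑ ^ q := by
  rw [tsum_eq_sum (s := F) fun j hj => by simp [hg, hj, hq]]
  rw [Finset.sum_congr rfl fun j hj => by rw [hg, if_pos hj]]
  simp

theorem mem_lqBall_of_sparse {g : H} {F : Finset ℕ+} {a : ℝ}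
    (hg : ∀ j, φ.repr g j = if j ∈ F then a else 0) (ha : 0 ≤ a) {m : ℕ} (hF : F.card ≤ m)
    {q R : ℝ} (hq : 0 < q) (hR : 0 ≤ R) (h : m * a ^ q ≤ R ^ q) : g ∈ lqBall φ q R := by
  rw [lqBall, Set.mem_ofPred_eq, tsum_enorm_repr_rpow hg hq]
  calc (F.card : ℝ≥0∞) * ‖a‖ₑ ^ q ≤ m * ‖a‖ₑ ^ q := by gcongr
    _ = ENNReal.ofReal (m * a ^ q) := by
        rw [ENNReal.ofReal_mul (by positivity), ENNReal.ofReal_natCast,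
          ← ENNReal.ofReal_rpow_of_nonneg ha hq.le, Real.enorm_of_nonneg ha]
    _ ≤ ENNReal.ofReal (R ^ q) := ENNReal.ofReal_le_ofReal h
    _ = _ := (ENNReal.ofReal_rpow_of_nonneg hR hq.le).symm

/-- Tails beyond `p` vanish; for J ≤ p the tail is at most the total energy and J^(2r) ≤ p^(2r). -/
theorem mem_besovBall_of_sparse {g : H} {F : Finset ℕ+} {a : ℝ}
    (hg : ∀ j, φ.repr g j = if j ∈ F then a else 0) (ha : 0 ≤ a) {m p : ℕ} (hF : F.card ≤ m)
    (hp : ∀ j ∈ F, (j : ℕ) ≤ p) {r R : ℝ} (hr : 0 < r) (hR : 0 ≤ R)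
    (h : (p : ℝ) ^ (2 * r) * (m * a ^ 2) ≤ R ^ 2) : g ∈ besovBall φ r R := by
  rw [besovBall, Set.mem_ofPred_eq]
  refine iSup_le fun J => ?_
  rcases le_or_gt (J : ℕ) p with hJ | hJ
  · have h2 : ∑' j : Set.Ici J, ‖φ.repr g j‖ₑ ^ 2 ≤ m * ‖a‖ₑ ^ 2 := by
      calc ∑' j : Set.Ici J, ‖φ.repr g j‖ₑ ^ 2 ≤ ∑' j : ℕ+, ‖φ.repr g j‖ₑ ^ 2 :=
            ENNReal.tsum_comp_le_tsum_of_injective Subtype.val_injective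
              fun j => ‖φ.repr g j‖ₑ ^ 2
        _ = F.card * ‖a‖ₑ ^ 2 := by
            have := tsum_enorm_repr_rpow hg two_pos
            simpa using this
        _ ≤ m * ‖a‖ₑ ^ 2 := by gcongr
    calc _ ≤ (p : ℝ≥0∞) ^ (2 * r) * (m * ‖a‖ₑ ^ 2) := by gcongr
      _ = ENNReal.ofReal ((p : ℝ) ^ (2 * r) * (m * a ^ 2)) := by
          rw [ENNReal.ofReal_mul (by positivity), ENNReal.ofReal_mul (by positivity),
            ENNReal.ofReal_natCast, ← ENNReal.ofReal_rpow_of_nonneg (by positivity) (by positivity),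
            ENNReal.ofReal_natCast, ENNReal.ofReal_pow ha, Real.enorm_of_nonneg ha]
      _ ≤ ENNReal.ofReal (R ^ 2) := ENNReal.ofReal_le_ofReal h
      _ = _ := ENNReal.ofReal_pow hR 2
  · have h0 : ∀ j : Set.Ici J, ‖φ.repr g j‖ₑ ^ 2 = 0 := fun j => by
      have hj : (J : ℕ) ≤ (j : ℕ+) := j.2
      have : (j : ℕ+) ∉ F := fun hmem => absurd (hp _ hmem) (by omega)
      simp [hg, this]
    simp [h0]

/-- The position in `ℕ+` of the `i`-th coordinate of the block `b`. -/
def blockPosition {m N : ℕ} (p : Fin m × Fin N) : ℕ+ :=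
  Nat.succPNat (finProdFinEquiv p)

theorem blockPosition_injective {m N : ℕ} :
    Function.Injective (blockPosition : Fin m × Fin N → ℕ+) :=
  Nat.succPNat_injective.comp (Fin.val_injective.comp finProdFinEquiv.injective)

theorem blockPosition_le {m N : ℕ} (p : Fin m × Fin N) : (blockPosition p : ℕ) ≤ m * N :=
  (finProdFinEquiv p).isLt

theorem orthonormal_blockPosition (φ : HilbertBasis ℕ+ ℝ H) (m N : ℕ) :
    Orthonormal ℝ fun p : Fin m × Fin N => φ (blockPosition p) :=
  φ.orthonormal.comp _ blockPosition_injective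

theorem repr_blockSignal {m N : ℕ} (φ : HilbertBasis ℕ+ ℝ H) (a : ℝ)
    (s : Fin m → Bool × Fin N) (j : ℕ+) :
    φ.repr (blockSignal (fun p => φ (blockPosition p)) a s) j
      = if j ∈ (Finset.univ.filter fun b => (s b).1).image fun b => blockPosition (b, (s b).2)
        then a else 0 := by
  rw [φ.repr_apply_apply]
  by_cases hj : ∃ p : Fin m × Fin N, blockPosition p = j
  · obtain ⟨⟨b, i⟩, rfl⟩ := hj
    refine (inner_blockSignal (orthonormal_blockPosition φ m N) a s b i).trans ?_
    refine if_congr ?_ rfl rfl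
    simp [blockPosition_injective.eq_iff]
  · rw [if_neg]
    · rw [blockSignal, inner_sum]
      refine Finset.sum_eq_zero fun b _ => ?_
      rw [inner_smul_right, φ.orthonormal.2 fun h => hj ⟨_, h.symm⟩, mul_zero]
    · intro h
      obtain ⟨b, -, hb⟩ := Finset.mem_image.1 h
      exact hj ⟨_, hb⟩

theorem blockSignal_mem_balls {m N : ℕ} (φ : HilbertBasis ℕ+ ℝ H) {a q r R : ℝ} (ha : 0 ≤ a)
    (hq : 0 < q) (hr : 0 < r) (hR : 0 ≤ R) (h1 : m * a ^ q ≤ R ^ q)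
    (h2 : ((m * N : ℕ) : ℝ) ^ (2 * r) * (m * a ^ 2) ≤ R ^ 2) (s : Fin m → Bool × Fin N) :
    blockSignal (fun p => φ (blockPosition p)) a s ∈ lqBall φ q R ∩ besovBall φ r R := by
  have hcard : ((Finset.univ.filter fun b => (s b).1).image
      fun b => blockPosition (b, (s b).2)).card ≤ m :=
    Finset.card_image_le.trans ((Finset.card_le_univ _).trans_eq (Fintype.card_fin m))
  refine ⟨mem_lqBall_of_sparse (repr_blockSignal φ a s) ha hcard hq hR h1,
    mem_besovBall_of_sparse (repr_blockSignal φ a s) ha hcard ?_ hr hR h2⟩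
  intro j hj
  obtain ⟨b, -, rfl⟩ := Finset.mem_image.1 hj
  exact blockPosition_le _

end SparseBalls

/-! ### Choice of parameters -/

section Calibration

/-- Combine u ≤ √x with log x = 2 log √x ≤ 2√x. -/
theorem mul_log_le_two_mul {x u : ℝ} (hx : 1 < x) (hux : u ^ 2 ≤ x) :
    u * Real.log x ≤ 2 * x := by
  have hx0 : 0 ≤ x := by linarith
  have h1 : u ≤ √x := Real.le_sqrt_of_sq_le hux
  have h2 : Real.log x ≤ 2 * √x := by
    have := Real.log_le_sub_one_of_pos (Real.sqrt_pos.2 (by linarith : 0 < x))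
    rw [Real.log_sqrt hx0] at this
    linarith
  calc u * Real.log x ≤ √x * (2 * √x) := by
        gcongr
        exact Real.log_nonneg hx.le
    _ = 2 * x := by
        rw [mul_left_comm, Real.mul_self_sqrt hx0]

/-- Choice of the number `m` of blocks, their size `N` and the signal-to-noise ratio `t`. -/
theorem exists_block_parameters {q r R ε u : ℝ} (hq1 : 1 < q) (hq2 : q < 2) (hr : 0 < r)
    (hR : 0 < R) (hε : 0 < ε) (hu : 0 < u) (hur : (q + u) * (2 * r) = 2 - q)
    (hx1 : 1 < R * ε⁻¹) (hux : u ^ 2 ≤ R * ε⁻¹) :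
    ∃ (m N : ℕ) (t : ℝ), 0 < N ∧ 0 < t ∧ Real.exp (t ^ 2) ≤ N + 1 ∧
      m * (ε * t) ^ q ≤ R ^ q ∧
      ((m * N : ℕ) : ℝ) ^ (2 * r) * (m * (ε * t) ^ 2) ≤ R ^ 2 ∧
      1 / 32 * u ^ (1 - q / 2) * R ^ q * (ε * √(Real.log (R * ε⁻¹))) ^ (2 - q)
        ≤ m * (ε * t) ^ 2 / 8 := by
  set x := R * ε⁻¹ with hx
  have hx0 : 0 < x := by linarith
  have hlog : 0 < Real.log x := Real.log_pos hx1
  -- The 1/2 in t² = (u/2) log x absorbs the 2 in log x ≤ 2 log A, giving exp(t²) ≤ A^u.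
  set t := √(u / 2) * √(Real.log x) with ht
  have ht0 : 0 < t := by positivity
  have ht2 : t ^ 2 = u / 2 * Real.log x := by
    rw [ht, mul_pow, Real.sq_sqrt (by positivity), Real.sq_sqrt hlog.le]
  set A := R / (ε * t) with hA
  have hA0 : 0 < A := by positivity
  have hAt : A * (ε * t) = R := by rw [hA]; field_simp
  have hA2 : x ≤ A ^ 2 := by
    have h1 : A ^ 2 = x ^ 2 / t ^ 2 := by rw [hA, hx]; field_simp
    rw [h1, le_div_iff₀ (by positivity), ht2]
    nlinarith [mul_log_le_two_mul hx1 hux]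
  have hlogA : Real.log x ≤ 2 * Real.log A := by
    have := Real.log_le_log hx0 hA2
    rwa [Real.log_pow, Nat.cast_ofNat] at this
  have hA1 : 1 ≤ A := by
    nlinarith
  have hAu : 1 ≤ A ^ u := Real.one_le_rpow hA1 hu.le
  have hAq : 1 ≤ A ^ q := Real.one_le_rpow hA1 (by linarith)
  have hm : (⌊A ^ q⌋₊ : ℝ) ≤ A ^ q := Nat.floor_le (by positivity)
  have hN : (⌊A ^ u⌋₊ : ℝ) ≤ A ^ u := Nat.floor_le (by positivity)
  refine ⟨⌊A ^ q⌋₊, ⌊A ^ u⌋₊, t, Nat.floor_pos.2 hAu, ht0, ?_, ?_, ?_, ?_⟩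
  · calc Real.exp (t ^ 2) ≤ Real.exp (Real.log A * u) := by
          rw [ht2]
          exact Real.exp_le_exp.2 (by nlinarith)
      _ = A ^ u := (Real.rpow_def_of_pos hA0 u).symm
      _ ≤ _ := (Nat.lt_floor_add_one _).le
  · calc _ ≤ A ^ q * (ε * t) ^ q := by gcongr
      _ = R ^ q := by rw [← Real.mul_rpow hA0.le (by positivity), hAt]
  · push_cast
    calc _ ≤ (A ^ q * A ^ u) ^ (2 * r) * (A ^ q * (ε * t) ^ 2) := by gcongr
      -- The value of u makes the exponents add up: (q + u)·2r + q = 2.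
      _ = A ^ (2 : ℝ) * (ε * t) ^ 2 := by
          rw [← Real.rpow_add hA0, ← Real.rpow_mul hA0.le, hur, ← mul_assoc, ← Real.rpow_add hA0]
          ring_nf
      _ = R ^ 2 := by rw [Real.rpow_two, ← mul_pow, hAt]
  -- The constant 1/32 is the given 1/8, times 1/2 for the floor in m, times 1/2 for replacing u by
  -- u/2.
  · have h1 : A ^ q / 2 ≤ (⌊A ^ q⌋₊ : ℝ) := by
      have h3 : (1 : ℝ) ≤ ⌊A ^ q⌋₊ := by exact_mod_cast Nat.floor_pos.2 hAq
      have h4 := Nat.lt_floor_add_one (A ^ q)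
      linarith
    have h2 : A ^ q * (ε * t) ^ 2 = R ^ q * (ε * t) ^ (2 - q) := by
      rw [← hAt, Real.mul_rpow hA0.le (by positivity), mul_assoc,
        ← Real.rpow_add (by positivity)]
      simp
    have h3 : (ε * t) ^ (2 - q) = (u / 2) ^ (1 - q / 2) * (ε * √(Real.log x)) ^ (2 - q) := by
      rw [ht, mul_left_comm, Real.mul_rpow (by positivity) (by positivity), Real.sqrt_eq_rpow,
        ← Real.rpow_mul (by positivity)]
      congr 2
      ring
    have h4 : u ^ (1 - q / 2) ≤ 2 * (u / 2) ^ (1 - q / 2) := by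
      rw [Real.div_rpow hu.le (by norm_num)]
      have h5 : (2 : ℝ) ^ (1 - q / 2) ≤ 2 := by
        simpa using Real.rpow_le_rpow_of_exponent_le one_le_two (by linarith : 1 - q / 2 ≤ 1)
      rw [← mul_div_assoc, le_div_iff₀ (by positivity), mul_comm]
      gcongr
    calc 1 / 32 * u ^ (1 - q / 2) * R ^ q * (ε * √(Real.log x)) ^ (2 - q)
        ≤ 1 / 32 * (2 * (u / 2) ^ (1 - q / 2)) * R ^ q * (ε * √(Real.log x)) ^ (2 - q) := by
          gcongr
      _ = A ^ q * (ε * t) ^ 2 / 16 := by rw [h2, h3]; ring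
      _ = A ^ q / 2 * (ε * t) ^ 2 / 8 := by ring
      _ ≤ _ := by gcongr

end Calibration

theorem proposition5p10 :
    ∃ κ : ℝ, 0 < κ ∧
      ∀ (H : Type*) [NormedAddCommGroup H] [InnerProductSpace ℝ H] [CompleteSpace H]
        [MeasurableSpace H] [BorelSpace H] (φ : HilbertBasis ℕ+ ℝ H)
        (Ω : Type*) [MeasurableSpace Ω] (P : Measure Ω) [IsProbabilityMeasure P]
        (W : H → Ω → ℝ), IsIsonormal P W →
      ∀ q r R ε u : ℝ, 1 < q → q < 2 → 0 < r → r < 1 / q - 1 / 2 → 0 < R → 0 < ε →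
        u = 1 / r - q * (1 + 1 / (2 * r)) →
        max (Real.exp 1 ^ 2) (u ^ 2) ≤ R * ε⁻¹ →
        0 < u ∧
        ENNReal.ofReal (κ * u ^ (1 - q / 2) * R ^ q *
            (ε * Real.sqrt (Real.log (R * ε⁻¹))) ^ (2 - q))
          ≤ gaussianMinimaxRisk P W ε (lqBall φ q R ∩ besovBall φ r R) := by
  refine ⟨1 / 32, by norm_num, ?_⟩
  intro H _ _ _ _ _ φ Ω _ P _ W hW q r R ε u hq1 hq2 hr hrq hR hε hu hx
  have hq0 : 0 < q := by linarith
  have hur : (q + u) * (2 * r) = 2 - q := by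
    rw [hu]
    field_simp
    ring
  -- The bound on r says 2qr < 2 - q = 2qr + 2ur.
  have hu0 : 0 < u := by
    have h1 : q * r < 1 - q / 2 := by
      calc q * r < q * (1 / q - 1 / 2) := by gcongr
        _ = 1 - q / 2 := by field_simp
    nlinarith
  have hx1 : 1 < R * ε⁻¹ := by
    have h1 : (1 : ℝ) < Real.exp 1 ^ 2 := one_lt_pow₀ (Real.one_lt_exp_iff.2 one_pos) two_ne_zero
    exact h1.trans_le ((le_max_left _ _).trans hx)
  obtain ⟨m, N, t, hN, ht, hexp, hlq, hbesov, hbound⟩ :=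
    exists_block_parameters hq1 hq2 hr hR hε hu0 hur hx1 ((le_max_right _ _).trans hx)
  refine ⟨hu0, (ENNReal.ofReal_le_ofReal hbound).trans ?_⟩
  have key := hW.blockSparse_risk_lower_bound (orthonormal_blockPosition φ m N) hN hexp ε
    (blockSignal_mem_balls φ (by positivity) hq0 hr hR.le hlq hbesov)
  have h4 : (4 : ℝ≥0∞) * ENNReal.ofReal (m * (ε * t) ^ 2 / 8)
      = m * ENNReal.ofReal ((ε * t) ^ 2 / 2) := by
    rw [← ENNReal.ofReal_natCast m, ← ENNReal.ofReal_mul (by positivity),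
      ← ENNReal.ofReal_ofNat 4, ← ENNReal.ofReal_mul (by positivity)]
    congr 1
    ring
  rw [← h4] at key
  rwa [ENNReal.mul_le_mul_iff_right (by norm_num) (by norm_num)] at key
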